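/- Let $\mathbb F$ be a field of characteristic $0$ and let $V$ be a vertex algebra over $\mathbb F$ (of purely even parity). That is, $V$ is an $\mathbb F$-vector space with a bilinear product $V\otimes V\to V((z))$, $a\otimes b\mapsto a(z)b=\sum_{n\in\mathbb Z}(a_{(n)}b)z^{-n-1}$, an operator $T\in\operatorname{End}V$ with $T(a(z)b)=(Ta)(z)b+a(z)Tb$ and $(Ta)(z)=\partial_z a(z)$, and a non-zero vector $|0\rangle$ with $|0\rangle(z)a=a$ and $a(z)|0\rangle\in a+zV[[z]]$, such that for all $a,b\in V$ there is an integer $N\ge 0$ with $(z-w)^N a(z)b(w)=(z-w)^N b(w)a(z)$. Put $$[a_\lambda b]=\sum_{n\ge 0}\frac{\lambda^n}{n!}a_{(n)}b\in V[\lambda],\qquad :ab:\;=a_{(-1)}b .$$ Then the following hold for all $a,b,c\in V$. (a) $(V,T,[\cdot_\lambda\cdot])$ is a Lie conformal algebra, i.e. the $\lambda$-bracket is $\mathbb F$-bilinear with values in $V[\lambda]$ and satisfies - $[Ta_\lambda b]=-\lambda[a_\lambda b]$ and $[a_\lambda Tb]=(\lambda+T)[a_\lambda b]$; - $[b_\lambda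 a]=-[a_{-\lambda-T}b]$, where the right-hand side means $-\sum_{n\ge0}\frac{(-\lambda-T)^n}{n!}a_{(n)}b$; - $[a_\lambda[b_\mu c]]=[[a_\lambda b]_{\lambda+\mu}c]+[b_\mu[a_\lambda c]]$ in $V[\lambda,\mu]$. (b) $(V,|0\rangle,T,::)$ is a quasicommutative, quasiassociative unital differential algebra, i.e. $:|0\rangle a:\;=a=\;:a|0\rangle:$, $\;T(:ab:)=\;:(Ta)b:+:a(Tb):$, and $$:ab:-:ba:\;=\int_{-T}^{0}[a_\lambda b]\,d\lambda,$$ $$::ab:c:-:a:bc::\;=\;:\Big(\int_0^T d\lambda\,a\Big)[b_\lambda c]:+:\Big(\int_0^T d\lambda\,b\Big)[a_\lambda c]:.$$ Here the integrals are formal: $\int_{-T}^0\lambda^n v\,d\lambda=-\frac{(-T)^{n+1}v}{n+1}$ for $v\in V$, and for $p(\lambda)=\sum_j\lambda^jv_j\in V[\lambda]$ one sets $:\big(\int_0^Td\lambda\,a\big)p(\lambda):\;=\sum_j:\frac{T^{j+1}a}{j+1}\,v_j:$. (c) The two operations are related by the noncommutative Wick formula in $V[\lambda]$: $$[a_\lambda:bc:]=\;:[a_\lambda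 b]c:+:b[a_\lambda c]:+\int_0^\lambda[[a_\lambda b]_\mu c]\,d\mu .$$ -/

import Mathlib

open Polynomial

noncomputable section

/-! ### Polynomials with coefficients in a vector space

`PolynomialModule 𝔽 V` is `V[λ]`, and `PolynomialModule 𝔽 (PolynomialModule 𝔽 V)` is `V[λ][μ]`
(inner variable `λ`, outer variable `μ`). -/

section FormalPolynomials

variable {𝔽 V W : Type*} [Field 𝔽] [AddCommGroup V] [Module 𝔽 V] [AddCommGroup W] [Module 𝔽 W]

/-- Substitution of an operator `s` on `W` for the variable, the coefficients being moved to `W`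
by `f`: it sends `∑ λ ^ n v_n` to `∑ s ^ n (f v_n)`. -/
def polySubst (f : V →ₗ[𝔽] W) (s : Module.End 𝔽 W) : PolynomialModule 𝔽 V →ₗ[𝔽] W :=
  Finsupp.lsum 𝔽 (fun n : ℕ => (s ^ n) ∘ₗ f) ∘ₗ
    (PolynomialModule.coeffLinearEquiv 𝔽 𝔽).toLinearMap

/-- The primitive with zero constant term: `λ ^ n v ↦ λ ^ (n + 1) / (n + 1) v`. -/
def polyPrimitive : PolynomialModule 𝔽 V →ₗ[𝔽] PolynomialModule 𝔽 V :=
  Finsupp.lsum 𝔽 (fun n : ℕ => ((n : 𝔽) + 1)⁻¹ • PolynomialModule.lsingle 𝔽 (n + 1)) ∘ₗ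
    (PolynomialModule.coeffLinearEquiv 𝔽 𝔽).toLinearMap

/-- The definite integral `∫_s^t p(λ) dλ` of `p ∈ V[λ]`, whose limits are operators `s`, `t`
on `V`: the primitive of `p` at `t` minus the primitive of `p` at `s`. -/
def polyIntegral (s t : Module.End 𝔽 V) (p : PolynomialModule 𝔽 V) : V :=
  polySubst LinearMap.id t (polyPrimitive p) - polySubst LinearMap.id s (polyPrimitive p)

variable (𝔽 V) in
/-- Multiplication by the variable on `V[λ]`. -/
def mulVar : Module.End 𝔽 (PolynomialModule 𝔽 V) :=
  Algebra.lsmul 𝔽 𝔽 (PolynomialModule 𝔽 V) (X : 𝔽[X])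

variable (𝔽 V) in
/-- Multiplication by `λ` on `V[λ][μ]`. -/
def mulLambda : Module.End 𝔽 (PolynomialModule 𝔽 (PolynomialModule 𝔽 V)) :=
  PolynomialModule.map 𝔽 (mulVar 𝔽 V)

variable (𝔽 V) in
/-- Multiplication by `μ` on `V[λ][μ]`. -/
def mulMu : Module.End 𝔽 (PolynomialModule 𝔽 (PolynomialModule 𝔽 V)) :=
  mulVar 𝔽 (PolynomialModule 𝔽 V)

variable (𝔽 V) in
/-- The inclusion of `V` in `V[λ][μ]` as constant polynomials. -/
def constTwo : V →ₗ[𝔽] PolynomialModule 𝔽 (PolynomialModule 𝔽 V) :=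
  PolynomialModule.lsingle 𝔽 0 ∘ₗ PolynomialModule.lsingle 𝔽 0

end FormalPolynomials

/-! ### Lie conformal algebras -/

section LieConformal

variable {𝔽 R : Type*} [Field 𝔽] [AddCommGroup R] [Module 𝔽 R]

/-- `[a_s [b_t c]]` in `R[λ][μ]`, for `s`, `t` among the operators of multiplication by
`λ`, `μ`, `λ + μ`. -/
def bracketRight (br : R →ₗ[𝔽] R →ₗ[𝔽] PolynomialModule 𝔽 R)
    (s t : Module.End 𝔽 (PolynomialModule 𝔽 (PolynomialModule 𝔽 R))) (a b c : R) :
    PolynomialModule 𝔽 (PolynomialModule 𝔽 R) :=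
  polySubst (polySubst (constTwo 𝔽 R) s ∘ₗ br a) t (br b c)

/-- `[[a_s b]_t c]` in `R[λ][μ]`, for `s`, `t` among the operators of multiplication by
`λ`, `μ`, `λ + μ`. -/
def bracketLeft (br : R →ₗ[𝔽] R →ₗ[𝔽] PolynomialModule 𝔽 R)
    (s t : Module.End 𝔽 (PolynomialModule 𝔽 (PolynomialModule 𝔽 R))) (a b c : R) :
    PolynomialModule 𝔽 (PolynomialModule 𝔽 R) :=
  polySubst (polySubst (constTwo 𝔽 R) t ∘ₗ br.flip c) s (br a b)

/-- `R`, as an `𝔽[∂]`-module through the operator `∂`, with the bilinear `λ`-bracket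
`br a b = [a_λ b] ∈ R[λ]`, is a Lie conformal algebra. -/
structure IsLieConformalAlgebra (D : Module.End 𝔽 R)
    (br : R →ₗ[𝔽] R →ₗ[𝔽] PolynomialModule 𝔽 R) : Prop where
  /-- `[∂a_λ b] = -λ [a_λ b]` -/
  sesquilinear_left : ∀ a b : R, br (D a) b = -(mulVar 𝔽 R (br a b))
  /-- `[a_λ ∂b] = (λ + ∂) [a_λ b]` -/
  sesquilinear_right : ∀ a b : R, br a (D b) = (mulVar 𝔽 R + PolynomialModule.map 𝔽 D) (br a b)
  /-- `[b_λ a] = -[a_{-λ-∂} b]`, where `-λ-∂` acts on the coefficients -/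
  skew : ∀ a b : R, br b a =
    -(polySubst (PolynomialModule.lsingle 𝔽 0) (-mulVar 𝔽 R - PolynomialModule.map 𝔽 D) (br a b))
  /-- `[a_λ [b_μ c]] = [[a_λ b]_{λ+μ} c] + [b_μ [a_λ c]]` -/
  jacobi : ∀ a b c : R, bracketRight br (mulLambda 𝔽 R) (mulMu 𝔽 R) a b c =
    bracketLeft br (mulLambda 𝔽 R) (mulLambda 𝔽 R + mulMu 𝔽 R) a b c +
      bracketRight br (mulMu 𝔽 R) (mulLambda 𝔽 R) b a c

end LieConformal

/-! ### Differential algebras with quantum corrections -/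

section Quasi

variable {𝔽 V : Type*} [Field 𝔽] [AddCommGroup V] [Module 𝔽 V]

/-- The bilinear product `mul` has the unit `e` and the derivation `D`
(neither commutativity nor associativity is asked for). -/
structure IsUnitalDifferentialAlgebra (e : V) (D : Module.End 𝔽 V) (mul : V →ₗ[𝔽] V →ₗ[𝔽] V) :
    Prop where
  unit_mul : ∀ a : V, mul e a = a
  mul_unit : ∀ a : V, mul a e = a
  leibniz : ∀ a b : V, D (mul a b) = mul (D a) b + mul a (D b)

/-- `:ab: - :ba: = ∫_{-D}^0 [a_λ b] dλ` -/
def IsQuasicommutative (D : Module.End 𝔽 V) (mul : V →ₗ[𝔽] V →ₗ[𝔽] V)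
    (br : V →ₗ[𝔽] V →ₗ[𝔽] PolynomialModule 𝔽 V) : Prop :=
  ∀ a b : V, mul a b - mul b a = polyIntegral (-D) 0 (br a b)

/-- `:(∫_0^D dλ a) p(λ):`, in which the powers of `D` obtained by integrating the powers of `λ`
act on `a` only: `λ ^ j v` contributes `:(D ^ (j + 1) a / (j + 1)) v:`. -/
def integralAct (D : Module.End 𝔽 V) (mul : V →ₗ[𝔽] V →ₗ[𝔽] V) (a : V)
    (p : PolynomialModule 𝔽 V) : V :=
  p.coeff.sum fun j v => mul (((j : 𝔽) + 1)⁻¹ • (D ^ (j + 1)) a) v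

/-- `::ab:c: - :a:bc:: = :(∫_0^D dλ a) [b_λ c]: + :(∫_0^D dλ b) [a_λ c]:` -/
def IsQuasiassociative (D : Module.End 𝔽 V) (mul : V →ₗ[𝔽] V →ₗ[𝔽] V)
    (br : V →ₗ[𝔽] V →ₗ[𝔽] PolynomialModule 𝔽 V) : Prop :=
  ∀ a b c : V, mul (mul a b) c - mul a (mul b c) =
    integralAct D mul a (br b c) + integralAct D mul b (br a c)

/-- `[a_λ :bc:] = :[a_λ b]c: + :b[a_λ c]: + ∫_0^λ [[a_λ b]_μ c] dμ` in `V[λ]`. -/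
def NoncommutativeWick (mul : V →ₗ[𝔽] V →ₗ[𝔽] V)
    (br : V →ₗ[𝔽] V →ₗ[𝔽] PolynomialModule 𝔽 V) : Prop :=
  ∀ a b c : V, br a (mul b c) =
    PolynomialModule.map 𝔽 (mul.flip c) (br a b) + PolynomialModule.map 𝔽 (mul b) (br a c) +
      polyIntegral 0 (mulVar 𝔽 V) (bracketLeft br (mulLambda 𝔽 V) (mulMu 𝔽 V) a b c)

end Quasi

/-! ### Vertex algebras -/

/-- Multiplication by `z - w` of a formal distribution `∑ f m n z ^ m w ^ n`. -/
def mulZSubW {U : Type*} [AddCommGroup U] (f : ℤ → ℤ → U) : ℤ → ℤ → U :=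
  fun m n => f (m - 1) n - f m (n - 1)

/-- A `z`-algebra: a bilinear product `a(z)b = Y a b ∈ V((z))` with a derivation `T` of it
satisfying `(Ta)(z) = ∂_z a(z)`. `HVertexOperator.coeff (Y a) n` is the coefficient of `z ^ n`
in `a(z)`. -/
structure ZAlgebra (𝔽 V : Type*) [Field 𝔽] [AddCommGroup V] [Module 𝔽 V] where
  Y : V →ₗ[𝔽] VertexOperator 𝔽 V
  T : Module.End 𝔽 V
  derivation : ∀ (a b : V) (n : ℤ), T (HVertexOperator.coeff (Y a) n b) =
    HVertexOperator.coeff (Y (T a)) n b + HVertexOperator.coeff (Y a) n (T b)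
  consistency : ∀ (a : V) (n : ℤ), HVertexOperator.coeff (Y (T a)) n =
    (n + 1) • HVertexOperator.coeff (Y a) (n + 1)

/-- A vertex algebra (of purely even parity): a local unital `z`-algebra. -/
structure VertexAlgebra (𝔽 V : Type*) [Field 𝔽] [AddCommGroup V] [Module 𝔽 V] extends
    ZAlgebra 𝔽 V where
  /-- The unit element `|0⟩`. -/
  vac : V
  vac_ne_zero : vac ≠ 0
  /-- `|0⟩(z) a = a` -/
  vac_left : ∀ a : V, Y vac a = HahnModule.of 𝔽 (HahnSeries.single 0 a)
  /-- `a(z)|0⟩ = a mod z V[[z]]` -/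
  vac_right_zero : ∀ a : V, HVertexOperator.coeff (Y a) 0 vac = a
  vac_right_neg : ∀ (a : V) (n : ℤ), n < 0 → HVertexOperator.coeff (Y a) n vac = 0
  /-- `(z - w) ^ N a(z) b(w) = (z - w) ^ N b(w) a(z)` for some `N` depending on `a`, `b` -/
  locality : ∀ a b : V, ∃ N : ℕ,
    mulZSubW^[N] (fun m n => HVertexOperator.coeff (Y a) m * HVertexOperator.coeff (Y b) n) =
      mulZSubW^[N] (fun m n => HVertexOperator.coeff (Y b) n * HVertexOperator.coeff (Y a) m)

namespace VertexAlgebra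

variable {𝔽 V : Type*} [Field 𝔽] [AddCommGroup V] [Module 𝔽 V] (A : VertexAlgebra 𝔽 V)

/-- The `n`-th product `a_(n) b`, the coefficient of `z ^ (-n-1)` in `a(z)b`. -/
def nProd (n : ℤ) : V →ₗ[𝔽] V →ₗ[𝔽] V :=
  LinearMap.proj n ∘ₗ VertexOperator.ncoeff ∘ₗ A.Y

/-- The normally ordered product `:ab: = a_(-1) b`. -/
def normalProd : V →ₗ[𝔽] V →ₗ[𝔽] V := A.nProd (-1)

theorem nProd_support_finite (a b : V) :
    (Function.support fun n : ℕ => ((n.factorial : 𝔽))⁻¹ • A.nProd n a b).Finite := by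
  set s := (HahnModule.of 𝔽).symm (A.Y a b) with hs
  refine (Set.finite_lt_nat (Int.toNat (-s.order))).subset ?_
  intro n hn
  by_contra h
  refine hn ?_
  have h0 : A.nProd n a b = 0 :=
    VertexOperator.ncoeff_eq_zero_of_lt_order (A.Y a) n b (by
      have h' : ¬ n < Int.toNat (-s.order) := h
      rw [← hs]
      omega)
  simp [h0]

/-- The `λ`-bracket `[a_λ b] = ∑_{n ≥ 0} λ ^ n / n! a_(n) b ∈ V[λ]`. -/
def lambdaBracket : V →ₗ[𝔽] V →ₗ[𝔽] PolynomialModule 𝔽 V :=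
  LinearMap.mk₂ 𝔽
    (fun a b => PolynomialModule.ofCoeff 𝔽
      (Finsupp.ofSupportFinite (fun n : ℕ => ((n.factorial : 𝔽))⁻¹ • A.nProd n a b)
        (A.nProd_support_finite a b)))
    (fun a a' b => by
      apply PolynomialModule.coeff_injective
      ext n
      change ((n.factorial : 𝔽))⁻¹ • A.nProd n (a + a') b =
        ((n.factorial : 𝔽))⁻¹ • A.nProd n a b + ((n.factorial : 𝔽))⁻¹ • A.nProd n a' b
      rw [map_add, LinearMap.add_apply, smul_add])
    (fun r a b => by
      apply PolynomialModule.coeff_injective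
      ext n
      change ((n.factorial : 𝔽))⁻¹ • A.nProd n (r • a) b =
        r • ((n.factorial : 𝔽))⁻¹ • A.nProd n a b
      rw [map_smul, LinearMap.smul_apply, smul_comm])
    (fun a b b' => by
      apply PolynomialModule.coeff_injective
      ext n
      change ((n.factorial : 𝔽))⁻¹ • A.nProd n a (b + b') =
        ((n.factorial : 𝔽))⁻¹ • A.nProd n a b + ((n.factorial : 𝔽))⁻¹ • A.nProd n a b'
      rw [map_add, smul_add])
    (fun r a b => by
      apply PolynomialModule.coeff_injective
      ext n
      change ((n.factorial : 𝔽))⁻¹ • A.nProd n a (r • b) =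
        r • ((n.factorial : 𝔽))⁻¹ • A.nProd n a b
      rw [map_smul, smul_comm])

theorem coeff_lambdaBracket (a b : V) (n : ℕ) :
    (A.lambdaBracket a b).coeff n = ((n.factorial : 𝔽))⁻¹ • A.nProd n a b := rfl

end VertexAlgebra

end

/-! Everything is read off from two identities for the n-th products: skew-symmetry
(`nProd_eq_neg_sum`) and the Borcherds identity (`borcherds`).

Skew-symmetry comes from `H(z, w) = (z - w)^N a(z) b(w)|0⟩` with `N` large. Since `T|0⟩ = 0`, `T`
acts on `H` as `∂_z + ∂_w`, so `H(z, 0) = exp(zT) H(0, -z)`; locality lets `H(0, w)` be computed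
with `a` and `b` in the other order.

The Borcherds identity compares three expansions of `z^m w^n (z - w)^k`. For large `k` it is
locality of `a` and `b`. For large `m` it is associativity, which skew-symmetry turns into locality
of `c` and `a`. All three sums obey the recurrence given by `z = w + (z - w)`, and this carries the
identity to all `m`, `n`, `k`.

Specializing: `k = 0`, `m ≥ 0` is the commutator formula, which gives Jacobi for `n ≥ 0` and Wick
for `n = -1`; `m = 0`, `n = k = -1` gives quasiassociativity. Skew-symmetry at `n ≥ 0` is that of
the `λ`-bracket, at `n = -1` quasicommutativity. The rest is bookkeeping of coefficients and
factorials. -/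

noncomputable section

/-! ### Binomial sums -/

section BinomialSums

variable {V : Type*} [AddCommGroup V]

/-- The sum `∑ j, (m choose j) F j`, for an integer `m` and a finitely supported `F`. -/
def binomialSum (m : ℤ) (F : ℕ → V) : V := ∑ᶠ j : ℕ, Ring.choose m j • F j

theorem binomialSum_eq_sum_range (m : ℤ) {F : ℕ → V} {J : ℕ} (h : ∀ j, J ≤ j → F j = 0) :
    binomialSum m F = ∑ j ∈ Finset.range J, Ring.choose m j • F j := by
  refine finsum_eq_sum_of_support_subset _ fun j hj => ?_
  by_contra hj'
  refine hj ?_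
  simp only [Finset.coe_range, Set.mem_Iio, not_lt] at hj'
  simp [h j hj']

theorem binomialSum_natCast (m : ℕ) (F : ℕ → V) :
    binomialSum (m : ℤ) F = ∑ j ∈ Finset.range (m + 1), m.choose j • F j := by
  have : binomialSum (m : ℤ) F = ∑ j ∈ Finset.range (m + 1), Ring.choose (m : ℤ) j • F j := by
    refine finsum_eq_sum_of_support_subset _ fun j hj => ?_
    by_contra hj'
    refine hj ?_
    simp only [Finset.coe_range, Set.mem_Iio, not_lt] at hj'
    simp [Ring.choose_natCast, Nat.choose_eq_zero_of_lt (show m < j by omega)]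
  rw [this]
  refine Finset.sum_congr rfl fun j _ => ?_
  rw [Ring.choose_natCast, natCast_zsmul]

theorem binomialSum_zero (F : ℕ → V) : binomialSum 0 F = F 0 := by
  simpa using binomialSum_natCast 0 F

/-- Pascal's rule. For negative `m` no binomial coefficient vanishes, so the bound `J` is what keeps
the `finsum` from its default value `0`. -/
theorem binomialSum_succ (m : ℤ) {F : ℕ → V} {J : ℕ} (h : ∀ j, J ≤ j → F j = 0) :
    binomialSum (m + 1) F = binomialSum m F + binomialSum m (fun j => F (j + 1)) := by
  rw [binomialSum_eq_sum_range (J := J + 1) _ (fun j hj => h j (by omega)),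
    binomialSum_eq_sum_range (J := J + 1) _ (fun j hj => h j (by omega)),
    binomialSum_eq_sum_range (J := J) m (F := fun j => F (j + 1)) (fun j hj => h _ (by omega)),
    Finset.sum_range_succ', Finset.sum_range_succ']
  simp only [Ring.choose_succ_succ, Ring.choose_zero_right, add_smul, Finset.sum_add_distrib]
  abel

/-- For a natural number `m`, Pascal's rule needs no finiteness of the support. -/
theorem binomialSum_natCast_succ (m : ℕ) (F : ℕ → V) :
    binomialSum ((m + 1 : ℕ) : ℤ) F = binomialSum m F + binomialSum m (fun j => F (j + 1)) := by
  rw [binomialSum_natCast, binomialSum_natCast, binomialSum_natCast,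
    Finset.sum_range_succ' _ (m + 1), Finset.sum_range_succ' (fun j => m.choose j • F j) m]
  simp only [Nat.choose_succ_succ', Nat.choose_zero_right, add_smul, Finset.sum_add_distrib]
  rw [Finset.sum_range_succ (fun k => m.choose (k + 1) • F (k + 1)) m, Nat.choose_succ_self,
    zero_smul]
  abel

theorem sum_range_eq_sum_range {F : ℕ → V} {J K : ℕ} (hJ : ∀ j, J ≤ j → F j = 0)
    (hK : ∀ j, K ≤ j → F j = 0) : ∑ j ∈ Finset.range J, F j = ∑ j ∈ Finset.range K, F j := by
  rw [← finsum_eq_sum_of_support_subset F (s := Finset.range J),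
    finsum_eq_sum_of_support_subset F (s := Finset.range K)]
  · intro j hj; by_contra h; exact hj (hK j (by simpa using h))
  · intro j hj; by_contra h; exact hj (hJ j (by simpa using h))

theorem binomialSum_neg (m : ℤ) (F : ℕ → V) :
    binomialSum m (fun j => -F j) = -binomialSum m F := by
  simp [binomialSum, finsum_neg_distrib]

end BinomialSums

/-- The binomial expansion of `(z - w)^N`; Pascal's rule is the inductive step. -/
theorem iterate_mulZSubW {U : Type*} [AddCommGroup U] (f : ℤ → ℤ → U) (N : ℕ) (m n : ℤ) :
    mulZSubW^[N] f m n = ∑ j ∈ Finset.range (N + 1),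
      N.choose j • ((-1 : ℤ) ^ j • f (m - N + j) (n - j)) := by
  rw [← binomialSum_natCast]
  induction N generalizing f m n with
  | zero => simp [binomialSum_zero]
  | succ N ih =>
    rw [binomialSum_natCast_succ, Function.iterate_succ_apply', mulZSubW, ih, ih, sub_eq_add_neg, ← binomialSum_neg]
    congr 2
    · funext j
      congr 2
      push_cast; ring
    · funext j
      rw [pow_succ, mul_neg_one, neg_smul]
      congr 3
      · push_cast; ring
      · push_cast; ring

theorem iterate_mulZSubW_natCast_le {U : Type*} [AddCommGroup U] {f g : ℤ → ℤ → U} {N M : ℕ}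
    (h : mulZSubW^[N] f = mulZSubW^[N] g) (hM : N ≤ M) : mulZSubW^[M] f = mulZSubW^[M] g := by
  obtain ⟨k, rfl⟩ := Nat.exists_eq_add_of_le' hM
  rw [Function.iterate_add_apply, h, ← Function.iterate_add_apply]

/-! ### The axioms in terms of n-th products, and divided powers of `T`. -/

namespace VertexAlgebra

variable {𝔽 V : Type*} [Field 𝔽] [AddCommGroup V] [Module 𝔽 V] (A : VertexAlgebra 𝔽 V)

theorem nProd_eq_coeff (n : ℤ) (a : V) :
    A.nProd n a = HVertexOperator.coeff (A.Y a) (-n - 1) := rfl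

theorem coeff_eq_nProd (n : ℤ) (a : V) :
    HVertexOperator.coeff (A.Y a) n = A.nProd (-n - 1) a := by
  rw [nProd_eq_coeff, show -(-n - 1) - 1 = n by ring]

theorem exists_nProd_eq_zero (a b : V) : ∃ N : ℕ, ∀ n : ℤ, N ≤ n → A.nProd n a b = 0 := by
  refine ⟨Int.toNat (-((HahnModule.of 𝔽).symm (A.Y a b)).order), fun n hn => ?_⟩
  exact VertexOperator.ncoeff_eq_zero_of_lt_order (A.Y a) n b (by omega)

theorem T_nProd (n : ℤ) (a b : V) :
    A.T (A.nProd n a b) = A.nProd n (A.T a) b + A.nProd n a (A.T b) :=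
  A.derivation a b _

theorem nProd_T (n : ℤ) (a b : V) : A.nProd n (A.T a) b = -n • A.nProd (n - 1) a b := by
  rw [nProd_eq_coeff, A.consistency, nProd_eq_coeff, LinearMap.smul_apply,
    show -n - 1 + 1 = -n by ring, show -(n - 1) - 1 = -n by ring]

theorem nProd_vac_left (n : ℤ) (a : V) : A.nProd n A.vac a = if n = -1 then a else 0 := by
  have : A.nProd n A.vac a = ((HahnModule.of 𝔽).symm (A.Y A.vac a)).coeff (-n - 1) := rfl
  rw [this, A.vac_left]
  simp only [Equiv.symm_apply_apply, HahnSeries.coeff_single]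
  congr 1
  simp only [eq_iff_iff]; omega

theorem nProd_neg_one_vac (a : V) : A.nProd (-1) a A.vac = a := A.vac_right_zero a

/-- Applying the derivation `T` to `|0⟩_(-1)|0⟩ = |0⟩` gives `T|0⟩ = 2 T|0⟩`. -/
theorem T_vac : A.T A.vac = 0 := by
  have h := A.T_nProd (-1) A.vac A.vac
  rw [nProd_vac_left, nProd_vac_left, nProd_neg_one_vac] at h
  simpa using h

/-- Locality, in terms of `n`-th products. -/
theorem exists_locality (a b : V) : ∃ N : ℕ, ∀ M : ℕ, N ≤ M → ∀ (p q : ℤ) (c : V),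
    ∑ j ∈ Finset.range (M + 1),
        M.choose j • ((-1 : ℤ) ^ j • A.nProd (p + M - j) a (A.nProd (q + j) b c)) =
      ∑ j ∈ Finset.range (M + 1),
        M.choose j • ((-1 : ℤ) ^ j • A.nProd (q + j) b (A.nProd (p + M - j) a c)) := by
  obtain ⟨N, hN⟩ := A.locality a b
  refine ⟨N, fun M hM p q c => ?_⟩
  have h := congrArg (fun f : Module.End 𝔽 V => f c)
    (congrFun (congrFun (iterate_mulZSubW_natCast_le hN hM) (-p - 1)) (-q - 1))
  simp only [iterate_mulZSubW, LinearMap.sum_apply, LinearMap.smul_apply, Module.End.mul_apply,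
    coeff_eq_nProd] at h
  have e1 : ∀ j : ℕ, -(-p - 1 - (M : ℤ) + j) - 1 = p + M - j := fun j => by ring
  have e2 : ∀ j : ℕ, -(-q - 1 - (j : ℤ)) - 1 = q + j := fun j => by ring
  simpa only [e1, e2] using h

section DividedPowers

/-- The divided power `T ^ j / j!`. -/
def divT (j : ℕ) : Module.End 𝔽 V := ((j.factorial : 𝔽))⁻¹ • A.T ^ j

theorem divT_zero (a : V) : A.divT 0 a = a := by simp [divT]

variable [CharZero 𝔽]

theorem T_divT (j : ℕ) (a : V) : A.T (A.divT j a) = ((j : ℤ) + 1) • A.divT (j + 1) a := by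
  have h : (j.factorial : 𝔽) ≠ 0 := Nat.cast_ne_zero.2 j.factorial_ne_zero
  have h' : ((j : 𝔽) + 1) ≠ 0 := by exact_mod_cast Nat.succ_ne_zero j
  rw [divT, divT, LinearMap.smul_apply, LinearMap.smul_apply, LinearMap.map_smul,
    ← Int.cast_smul_eq_zsmul 𝔽, smul_smul, pow_succ', Module.End.mul_apply, Nat.factorial_succ]
  congr 1
  push_cast
  field_simp

/-- Divided-power identities are proved by induction after multiplying by `n + 1`; characteristic 0
allows the cancellation. -/
theorem succ_zsmul_cancel (𝔽 : Type*) {V : Type*} [Field 𝔽] [CharZero 𝔽] [AddCommGroup V]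
    [Module 𝔽 V] (n : ℕ) {a b : V} (h : ((n : ℤ) + 1) • a = ((n : ℤ) + 1) • b) : a = b := by
  rw [← Int.cast_smul_eq_zsmul 𝔽, ← Int.cast_smul_eq_zsmul 𝔽] at h
  refine smul_right_injective V ?_ h
  push_cast
  exact_mod_cast Nat.succ_ne_zero n

/-- The coefficient of `x^j` in Taylor's formula `(e^{xT} a)(z) = a(z + x)`. -/
theorem nProd_divT (j : ℕ) (n : ℤ) (a b : V) :
    A.nProd n (A.divT j a) b = ((-1 : ℤ) ^ j * Ring.choose n j) • A.nProd (n - j) a b := by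
  induction j generalizing n with
  | zero => simp [divT_zero]
  | succ j ih =>
    apply succ_zsmul_cancel 𝔽 j
    rw [← LinearMap.smul_apply, ← map_zsmul, ← T_divT, nProd_T, ih, smul_smul, smul_smul]
    have h : ((j : ℤ) + 1) * Ring.choose n (j + 1) = n * Ring.choose (n - 1) j := by
      have h1 := Ring.choose_smul_choose n (n := j + 1) (k := 1) (by omega)
      simp at h1
      linarith
    congr 1
    · rw [pow_succ]; linear_combination (-1) ^ j * h
    · rw [show n - 1 - (j : ℤ) = n - (j + 1 : ℕ) by push_cast; ring]

/-- Since `T` is a derivation of every n-th product, `e^{xT}` is an automorphism. -/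
theorem divT_nProd (i : ℕ) (n : ℤ) (a b : V) :
    A.divT i (A.nProd n a b) =
      ∑ r ∈ Finset.range (i + 1), A.nProd n (A.divT r a) (A.divT (i - r) b) := by
  rw [← Finset.Nat.sum_antidiagonal_eq_sum_range_succ
    (fun r s => A.nProd n (A.divT r a) (A.divT s b))]
  induction i with
  | zero => simp [divT_zero]
  | succ i ih =>
    apply succ_zsmul_cancel 𝔽 i
    rw [← T_divT, ih, map_sum]
    simp only [T_nProd, T_divT, Finset.sum_add_distrib, map_zsmul, LinearMap.smul_apply]
    -- The factor `i + 1` splits as `p.1 + p.2`: one part accounts for `T` acting on `a`, the other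
    -- for `T` acting on `b`.
    have e : ((i : ℤ) + 1) • ∑ p ∈ Finset.HasAntidiagonal.antidiagonal (i + 1),
        A.nProd n (A.divT p.1 a) (A.divT p.2 b) =
        ∑ p ∈ Finset.HasAntidiagonal.antidiagonal (i + 1), (p.1 : ℤ) • A.nProd n (A.divT p.1 a) (A.divT p.2 b) +
        ∑ p ∈ Finset.HasAntidiagonal.antidiagonal (i + 1), (p.2 : ℤ) • A.nProd n (A.divT p.1 a) (A.divT p.2 b) := by
      rw [← Finset.sum_add_distrib, Finset.smul_sum]
      refine Finset.sum_congr rfl fun p hp => ?_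
      rw [← add_smul]
      congr 1
      have := Finset.HasAntidiagonal.mem_antidiagonal.1 hp
      exact_mod_cast this.symm
    rw [e, Finset.Nat.sum_antidiagonal_succ, Finset.Nat.sum_antidiagonal_succ' (n := i)
      (f := fun p : ℕ × ℕ => (p.2 : ℤ) • A.nProd n (A.divT p.1 a) (A.divT p.2 b))]
    simp

/-- A `T`-equivariant power series `H(z, w)`, i.e. `T H = (∂_z + ∂_w) H`, satisfies
`H(z, 0) = exp(z T) H(0, -z)`. -/
theorem eq_sum_divT_of_equivariant {H : ℕ → ℕ → V}
    (h : ∀ m n, A.T (H m n) = ((m : ℤ) + 1) • H (m + 1) n + ((n : ℤ) + 1) • H m (n + 1))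
    (m n : ℕ) : H m n = ∑ p ∈ Finset.HasAntidiagonal.antidiagonal m,
      ((-1 : ℤ) ^ p.2 * (n + p.2).choose p.2) • A.divT p.1 (H 0 (n + p.2)) := by
  induction m generalizing n with
  | zero => simp [divT_zero]
  | succ m ih =>
    apply succ_zsmul_cancel 𝔽 m
    rw [← sub_eq_of_eq_add (h m n), ih, ih, map_sum]
    have e : ((m : ℤ) + 1) • ∑ p ∈ Finset.HasAntidiagonal.antidiagonal (m + 1),
          ((-1 : ℤ) ^ p.2 * (n + p.2).choose p.2) • A.divT p.1 (H 0 (n + p.2)) =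
        ∑ p ∈ Finset.HasAntidiagonal.antidiagonal (m + 1), (p.1 : ℤ) •
          ((-1 : ℤ) ^ p.2 * (n + p.2).choose p.2) • A.divT p.1 (H 0 (n + p.2)) +
        ∑ p ∈ Finset.HasAntidiagonal.antidiagonal (m + 1), (p.2 : ℤ) •
          ((-1 : ℤ) ^ p.2 * (n + p.2).choose p.2) • A.divT p.1 (H 0 (n + p.2)) := by
      rw [← Finset.sum_add_distrib, Finset.smul_sum]
      refine Finset.sum_congr rfl fun p hp => ?_
      rw [← add_smul]
      congr 1
      have := Finset.HasAntidiagonal.mem_antidiagonal.1 hp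
      exact_mod_cast this.symm
    rw [e, Finset.Nat.sum_antidiagonal_succ, Finset.Nat.sum_antidiagonal_succ' (n := m)
      (f := fun p : ℕ × ℕ => (p.2 : ℤ) •
          ((-1 : ℤ) ^ p.2 * (n + p.2).choose p.2) • A.divT p.1 (H 0 (n + p.2)))]
    simp only [map_zsmul, T_divT, Nat.cast_zero, zero_smul, zero_add, add_zero,
      sub_eq_add_neg, Finset.smul_sum, ← Finset.sum_neg_distrib]
    congr 1
    · refine Finset.sum_congr rfl fun p _ => ?_
      rw [smul_comm]; push_cast; rfl
    · refine Finset.sum_congr rfl fun p _ => ?_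
      rw [smul_smul, ← neg_smul, smul_smul, show n + 1 + p.2 = n + (p.2 + 1) by ring]
      congr 1
      have h3 : (n + 1) * (n + (p.2 + 1)).choose p.2 =
          (p.2 + 1) * (n + (p.2 + 1)).choose (p.2 + 1) := by
        have := Nat.choose_succ_right_eq (n + (p.2 + 1)) p.2
        rw [show n + (p.2 + 1) - p.2 = n + 1 by omega] at this
        linarith
      have h4 : ((n : ℤ) + 1) * ((n + (p.2 + 1)).choose p.2 : ℕ) =
          ((p.2 : ℤ) + 1) * ((n + (p.2 + 1)).choose (p.2 + 1) : ℕ) := by exact_mod_cast h3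
      rw [pow_succ]
      push_cast
      linear_combination -(-1) ^ p.2 * h4

end DividedPowers

end VertexAlgebra

/-! ### Signs and skew-symmetry. -/

namespace VertexAlgebra

variable {𝔽 V : Type*} [Field 𝔽] [AddCommGroup V] [Module 𝔽 V] (A : VertexAlgebra 𝔽 V)

theorem choose_neg_one (j : ℕ) : Ring.choose (-1 : ℤ) j = (-1) ^ j := by
  induction j with
  | zero => simp
  | succ j ih =>
    have h := Ring.choose_succ_succ (-1 : ℤ) j
    rw [neg_add_cancel, Ring.choose_zero_succ, ih] at h
    rw [pow_succ]
    linarith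

theorem negOnePow_natCast (j : ℕ) : (((j : ℤ).negOnePow : ℤˣ) : ℤ) = (-1) ^ j := by
  simp [Int.negOnePow_def]

theorem negOnePow_add_natCast (n : ℤ) (j : ℕ) :
    (((n + j).negOnePow : ℤˣ) : ℤ) = n.negOnePow * (-1) ^ j := by
  rw [Int.negOnePow_add, Units.val_mul, negOnePow_natCast]

theorem negOnePow_sub_natCast (n : ℤ) (j : ℕ) :
    (((n - j).negOnePow : ℤˣ) : ℤ) = n.negOnePow * (-1) ^ j := by
  rw [Int.negOnePow_sub, Units.val_mul, negOnePow_natCast]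

/-- Multiplication by `z - w` commutes with `∂_z + ∂_w`, because `(∂_z + ∂_w)(z - w) = 0`. -/
theorem T_iterate_mulZSubW {f : ℤ → ℤ → V}
    (hf : ∀ m n, A.T (f m n) = (m + 1) • f (m + 1) n + (n + 1) • f m (n + 1)) (N : ℕ) (m n : ℤ) :
    A.T (mulZSubW^[N] f m n) =
      (m + 1) • mulZSubW^[N] f (m + 1) n + (n + 1) • mulZSubW^[N] f m (n + 1) := by
  induction N generalizing m n with
  | zero => exact hf m n
  | succ N ih =>
    simp only [Function.iterate_succ_apply', mulZSubW, map_sub, ih, sub_add_cancel,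
      add_sub_cancel_right]
    module

section SkewSymmetry

variable [CharZero 𝔽]

/-- Skew-symmetry: `a_(n) b = -∑ j, (-1) ^ (n + j) T ^ j / j! (b_(n + j) a)`. -/
theorem nProd_eq_neg_sum (a b : V) (n : ℤ) {J : ℕ}
    (hJ : ∀ j : ℕ, J ≤ j → A.nProd (n + j) b a = 0) :
    A.nProd n a b = -∑ j ∈ Finset.range J,
      ((n + j).negOnePow : ℤ) • A.divT j (A.nProd (n + j) b a) := by
  obtain ⟨N₁, hN₁⟩ := A.locality a b
  obtain ⟨N₂, hN₂⟩ := A.exists_nProd_eq_zero b a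
  -- `a_(n) b` is the coefficient of `z^m` in `z^N a(z)b` for `m = N - 1 - n`, so `N` must also
  -- exceed `n` to make `m` natural. `N₂ ≤ N` makes the terms beyond `j = m` vanish.
  obtain ⟨N, h1, h2, m, hm⟩ : ∃ N : ℕ, N₁ ≤ N ∧ N₂ ≤ N ∧ ∃ m : ℕ, (m : ℤ) = N - 1 - n := by
    refine ⟨N₁ + N₂ + (n + 1).toNat, by omega, by omega,
      ((N₁ + N₂ + (n + 1).toNat : ℕ) - 1 - n : ℤ).toNat, by omega⟩
  have hloc := iterate_mulZSubW_natCast_le hN₁ h1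
  set f : ℤ → ℤ → V := fun m n => HVertexOperator.coeff (A.Y a) m
    (HVertexOperator.coeff (A.Y b) n A.vac) with hf
  set g : ℤ → ℤ → V := fun m n => HVertexOperator.coeff (A.Y b) n
    (HVertexOperator.coeff (A.Y a) m A.vac) with hg
  have hfg : ∀ p q, mulZSubW^[N] f p q = mulZSubW^[N] g p q := fun p q => by
    have h := congrArg (fun F : Module.End 𝔽 V => F A.vac) (congrFun (congrFun hloc p) q)
    simp only [iterate_mulZSubW, LinearMap.sum_apply, LinearMap.smul_apply,
      Module.End.mul_apply] at h
    simpa only [iterate_mulZSubW, hf, hg] using h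
  have hT : ∀ p q, A.T (f p q) = (p + 1) • f (p + 1) q + (q + 1) • f p (q + 1) := fun p q => by
    simp only [hf, A.derivation, A.consistency, T_vac, map_zero, add_zero, LinearMap.smul_apply,
      map_zsmul]
  have hH := A.eq_sum_divT_of_equivariant (H := fun p q : ℕ => mulZSubW^[N] f p q)
    (fun p q => by exact_mod_cast A.T_iterate_mulZSubW hT N p q) m 0
  -- Setting `w = 0`: as `b(w)|0⟩` has no negative powers of `w`, only `z^N` survives from `(z -
  -- w)^N`.
  have e1 : mulZSubW^[N] f m (0 : ℕ) = A.nProd n a b := by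
    rw [iterate_mulZSubW, Finset.sum_eq_single 0]
    · simp only [hf, coeff_eq_nProd]
      rw [show -((0 : ℕ) - ((0 : ℕ) : ℤ)) - 1 = -1 by simp, nProd_neg_one_vac,
        show -((m : ℤ) - N + (0 : ℕ)) - 1 = n by push_cast; linarith]
      simp
    · intro j _ hj
      simp only [hf]
      rw [A.vac_right_neg _ _ (by omega)]
      simp
    · simp
  -- Setting `z = 0` after exchanging `a` and `b` by locality: only `(-w)^N` survives.
  have e2 : ∀ k : ℕ, mulZSubW^[N] f (0 : ℕ) k = (-1 : ℤ) ^ N • A.nProd (N - 1 - k) b a := by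
    intro k
    rw [hfg, iterate_mulZSubW, Finset.sum_eq_single N]
    · simp only [hg, coeff_eq_nProd]
      rw [show -(((0 : ℕ) : ℤ) - N + N) - 1 = -1 by simp, nProd_neg_one_vac,
        show -((k : ℤ) - N) - 1 = N - 1 - k by ring]
      simp
    · intro j hj hj'
      have := Finset.mem_range.1 hj
      simp only [hg]
      rw [A.vac_right_neg _ _ (by omega)]
      simp
    · simp
  rw [e1, Finset.Nat.sum_antidiagonal_eq_sum_range_succ_mk] at hH
  rw [hH, ← Finset.sum_neg_distrib, sum_range_eq_sum_range (J := J) (K := m + 1)]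
  · refine Finset.sum_congr rfl fun i hi => ?_
    have := Finset.mem_range.1 hi
    simp only [zero_add, e2]
    rw [map_zsmul, smul_smul, show (N : ℤ) - 1 - (m - i : ℕ) = n + i by omega, ← neg_smul]
    congr 1
    rw [Nat.choose_self, Nat.cast_one, mul_one, ← negOnePow_natCast, ← negOnePow_natCast,
      ← Units.val_mul, ← Int.negOnePow_add, show ((m - i : ℕ) : ℤ) + N = (n + i) + 1 + 2 * (m - i)
        by push_cast [show i ≤ m by omega]; linarith, Int.negOnePow_add, Int.negOnePow_two_mul,
      mul_one, Int.negOnePow_succ, Units.val_neg]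
  · intro j hj
    rw [hJ j hj]; simp
  · intro j hj
    rw [hN₂ _ (by omega)]; simp

/-- Commuting divided powers of `T` past `a_(p)` in the skew-symmetry expansion of `b_(l) c`. -/
theorem neg_sum_divT_nProd_nProd (a b c : V) (p l : ℤ) {I : ℕ}
    (hI : ∀ i : ℕ, I ≤ i → A.nProd (l + i) c b = 0) :
    -∑ i ∈ Finset.range I,
        ((l + i).negOnePow : ℤ) • A.divT i (A.nProd p a (A.nProd (l + i) c b)) =
      binomialSum p fun r : ℕ => (-1 : ℤ) ^ r • A.nProd (p - r) a (A.nProd (l + r) b c) := by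
  have hskew : ∀ r : ℕ, A.nProd (l + r) b c = -∑ s ∈ Finset.range (I - r),
      ((l + r + s).negOnePow : ℤ) • A.divT s (A.nProd (l + r + s) c b) := fun r =>
    A.nProd_eq_neg_sum b c (l + r) fun j hj => by
      rw [add_assoc, ← Nat.cast_add]; exact hI _ (by omega)
  rw [binomialSum_eq_sum_range (J := I)]
  · simp only [A.divT_nProd _ p a, Finset.smul_sum]
    -- The sum over `r ≤ i` is reindexed by `i = r + s`. For fixed `r` the sum over `s` is
    -- skew-symmetry for `b_(l + r) c`, and moving `T^r / r!` off `a` produces the binomial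
    -- coefficient.
    have h := Finset.sum_range_diag_flip I (fun r s : ℕ => ((l + (r + s : ℕ)).negOnePow : ℤ) •
      A.nProd p (A.divT r a) (A.divT s (A.nProd (l + (r + s : ℕ)) c b)))
    have e : ∀ i, ∑ r ∈ Finset.range (i + 1), ((l + i).negOnePow : ℤ) •
        A.nProd p (A.divT r a) (A.divT (i - r) (A.nProd (l + i) c b)) =
        ∑ r ∈ Finset.range (i + 1), ((l + (r + (i - r) : ℕ)).negOnePow : ℤ) •
        A.nProd p (A.divT r a) (A.divT (i - r) (A.nProd (l + (r + (i - r) : ℕ)) c b)) := by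
      intro i
      refine Finset.sum_congr rfl fun r hr => ?_
      rw [Nat.add_sub_cancel' (Nat.lt_succ_iff.1 (Finset.mem_range.1 hr))]
    rw [Finset.sum_congr rfl fun i _ => e i, h, ← Finset.sum_neg_distrib]
    refine Finset.sum_congr rfl fun r _ => ?_
    rw [smul_smul, mul_comm, hskew r, map_neg, map_sum, smul_neg, Finset.smul_sum]
    congr 1
    refine Finset.sum_congr rfl fun s _ => ?_
    rw [nProd_divT, smul_comm, map_zsmul, Nat.cast_add, add_assoc]
  · intro j hj
    rw [hskew j, Nat.sub_eq_zero_of_le hj]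
    simp

end SkewSymmetry

/-! ### The Borcherds identity -/

section Borcherds

/-- `∑ j, (m choose j) (a_(k + j) b)_(m + n - j) c` -/
def iterateSum (a b c : V) (m n k : ℤ) : V :=
  binomialSum m fun j : ℕ => A.nProd (m + n - j) (A.nProd (k + j) a b) c

/-- `∑ j, (-1) ^ j (k choose j) a_(m + k - j) b_(n + j) c` -/
def productSum (a b c : V) (m n k : ℤ) : V :=
  binomialSum k fun j : ℕ => (-1 : ℤ) ^ j • A.nProd (m + k - j) a (A.nProd (n + j) b c)

/-- `∑ j, (-1) ^ (k + j) (k choose j) b_(n + k - j) a_(m + j) c` -/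
def oppositeSum (a b c : V) (m n k : ℤ) : V :=
  binomialSum k fun j : ℕ =>
    ((k + j).negOnePow : ℤ) • A.nProd (n + k - j) b (A.nProd (m + j) a c)

variable (a b c : V) (m n k : ℤ)

/-- As in the two analogues below, the source is `z = w + (z - w)` multiplied by `z^m w^n (z -
w)^k`. Here `z^m` is expanded in powers of `z - w`; in the other two, `(z - w)^k` is expanded in
powers of `w` or of `z`. -/
theorem iterateSum_succ : A.iterateSum a b c (m + 1) n k =
    A.iterateSum a b c m (n + 1) k + A.iterateSum a b c m n (k + 1) := by
  obtain ⟨N, hN⟩ := A.exists_nProd_eq_zero a b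
  rw [iterateSum, binomialSum_succ (J := (N - k).toNat)]
  · simp only [iterateSum]
    congr 2
    · funext j; rw [show m + 1 + n - j = m + (n + 1) - j by ring]
    · funext j
      rw [show m + 1 + n - (j + 1 : ℕ) = m + n - j by push_cast; ring,
        show k + (j + 1 : ℕ) = k + 1 + j by push_cast; ring]
  · intro j hj
    rw [hN _ (by omega)]; simp

theorem productSum_succ : A.productSum a b c (m + 1) n k =
    A.productSum a b c m (n + 1) k + A.productSum a b c m n (k + 1) := by
  obtain ⟨N, hN⟩ := A.exists_nProd_eq_zero b c
  rw [show A.productSum a b c m n (k + 1) = binomialSum (k + 1) _ from rfl, binomialSum_succ (J := (N - n).toNat)]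
  · have e : (fun j : ℕ => (-1 : ℤ) ^ (j + 1) •
        A.nProd (m + (k + 1) - (j + 1 : ℕ)) a (A.nProd (n + (j + 1 : ℕ)) b c)) = fun j : ℕ =>
        -((-1 : ℤ) ^ j • A.nProd (m + k - j) a (A.nProd (n + 1 + j) b c)) := by
      funext j
      rw [pow_succ, mul_neg_one, neg_smul,
        show m + (k + 1) - (j + 1 : ℕ) = m + k - j by push_cast; ring,
        show n + (j + 1 : ℕ) = n + 1 + j by push_cast; ring]
    rw [e, binomialSum_neg]
    simp only [productSum, show m + 1 + k = m + (k + 1) by ring]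
    abel
  · intro j hj
    rw [hN _ (by omega)]; simp

theorem oppositeSum_succ : A.oppositeSum a b c (m + 1) n k =
    A.oppositeSum a b c m (n + 1) k + A.oppositeSum a b c m n (k + 1) := by
  obtain ⟨N, hN⟩ := A.exists_nProd_eq_zero a c
  rw [show A.oppositeSum a b c m n (k + 1) = binomialSum (k + 1) _ from rfl, binomialSum_succ (J := (N - m).toNat)]
  · have e : (fun j : ℕ => ((k + 1 + (j + 1 : ℕ)).negOnePow : ℤ) •
        A.nProd (n + (k + 1) - (j + 1 : ℕ)) b (A.nProd (m + (j + 1 : ℕ)) a c)) = fun j : ℕ =>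
        ((k + j).negOnePow : ℤ) • A.nProd (n + k - j) b (A.nProd (m + 1 + j) a c) := by
      funext j
      rw [show k + 1 + (j + 1 : ℕ) = k + j + 1 + 1 by push_cast; ring, Int.negOnePow_succ,
        Int.negOnePow_succ, neg_neg,
        show n + (k + 1) - (j + 1 : ℕ) = n + k - j by push_cast; ring,
        show m + (j + 1 : ℕ) = m + 1 + j by push_cast; ring]
    have e' : (fun j : ℕ => ((k + 1 + j).negOnePow : ℤ) •
        A.nProd (n + (k + 1) - j) b (A.nProd (m + j) a c)) = fun j : ℕ =>
        -(((k + j).negOnePow : ℤ) • A.nProd (n + 1 + k - j) b (A.nProd (m + j) a c)) := by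
      funext j
      rw [show k + 1 + (j : ℤ) = k + j + 1 by ring, Int.negOnePow_succ, Units.val_neg, neg_smul,
        show n + (k + 1) - (j : ℤ) = n + 1 + k - j by ring]
    rw [e, e', binomialSum_neg]
    simp only [oppositeSum]
    abel
  · intro j hj
    rw [hN _ (by omega)]; simp

/-- For large `k` every `a_(k + j) b` is zero, and the two remaining sums agree by locality, with
the opposite one read backwards. -/
theorem borcherds_of_locality (a b c : V) :
    ∃ N : ℕ, ∀ m n k : ℤ, N ≤ k →
      A.iterateSum a b c m n k = A.productSum a b c m n k - A.oppositeSum a b c m n k := by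
  obtain ⟨N₁, hN₁⟩ := A.exists_locality a b
  obtain ⟨N₂, hN₂⟩ := A.exists_nProd_eq_zero a b
  refine ⟨N₁ + N₂, fun m n k hk => ?_⟩
  lift k to ℕ using by omega
  have h1 : A.iterateSum a b c m n k = 0 := by
    rw [iterateSum, binomialSum_eq_sum_range (J := 0)]
    · simp
    · intro j _
      rw [hN₂ _ (by omega)]; simp
  rw [h1, eq_comm, sub_eq_zero, productSum, oppositeSum, binomialSum_natCast, binomialSum_natCast,
    hN₁ k (by omega), ← Finset.sum_range_reflect]
  refine Finset.sum_congr rfl fun j hj => ?_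
  have hj' : j ≤ k := Nat.lt_succ_iff.1 (Finset.mem_range.1 hj)
  rw [show k + 1 - 1 - j = k - j by omega, Nat.choose_symm hj', ← Nat.cast_add, negOnePow_natCast,
    show n + ((k - j : ℕ) : ℤ) = n + k - j by omega, show m + k - ((k - j : ℕ) : ℤ) = m + j by omega]
  congr 2
  rw [show k + j = (k - j) + 2 * j by omega, pow_add, pow_mul]
  simp

/-- Iterating the recurrence `m` times expands `z^m = (w + (z - w))^m`. -/
theorem binomialSum_productSum (a b c : V) (m : ℕ) (n k : ℤ) :
    binomialSum m (fun j : ℕ => A.productSum a b c 0 (m + n - j) (k + j)) =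
      A.productSum a b c m n k := by
  induction m generalizing n k with
  | zero => simp [binomialSum_zero]
  | succ m ih =>
    rw [binomialSum_natCast_succ, Nat.cast_succ, productSum_succ, ← ih, ← ih]
    congr 2
    · funext j; congr 1; ring
    · funext j; congr 1 <;> (push_cast; ring)

variable [CharZero 𝔽]

/-- For large `m` every `a_(m + j) c` is zero. Skew-symmetry moves `c` to the left in the two other
sums; under each `T^i / i!` there remains locality of `c` and `a`, applied to `b`. -/
theorem borcherds_of_associativity (a b c : V) :
    ∃ M : ℕ, ∀ m n k : ℤ, M ≤ m →
      A.iterateSum a b c m n k = A.productSum a b c m n k - A.oppositeSum a b c m n k := by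
  obtain ⟨M₁, hM₁⟩ := A.exists_locality c a
  obtain ⟨M₂, hM₂⟩ := A.exists_nProd_eq_zero a c
  refine ⟨M₁ + M₂, fun m n k hm => ?_⟩
  lift m to ℕ using by omega
  have h1 : A.oppositeSum a b c m n k = 0 := by
    rw [oppositeSum, binomialSum_eq_sum_range (J := 0)]
    · simp
    · intro j _
      rw [hM₂ _ (by omega)]; simp
  choose L hL using fun u => A.exists_nProd_eq_zero c u
  -- A bound valid for `b` and for all `a_(k + j) b` with `j ≤ m`, so that all skew-symmetry
  -- expansions share the length `I`.
  set K : ℕ := L b + ∑ j ∈ Finset.range (m + 1), L (A.nProd (k + j) a b) with hK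
  set I : ℕ := (K - n).toNat with hI
  have hLj : ∀ j ∈ Finset.range (m + 1), L (A.nProd (k + j) a b) ≤ K := fun j hj =>
    (Finset.single_le_sum (f := fun j : ℕ => L (A.nProd (k + j) a b)) (fun _ _ => Nat.zero_le _)
      hj).trans (Nat.le_add_left _ _)
  rw [h1, sub_zero, ← binomialSum_productSum, iterateSum, binomialSum_natCast, binomialSum_natCast]
  have e1 : ∀ j ∈ Finset.range (m + 1),
      m.choose j • A.nProd (m + n - j) (A.nProd (k + j) a b) c =
      -∑ i ∈ Finset.range I, ((m + n + i).negOnePow : ℤ) • A.divT i (m.choose j • ((-1 : ℤ) ^ j •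
        A.nProd (m + n + i - j) c (A.nProd (k + j) a b))) := by
    intro j hj
    have := Finset.mem_range.1 hj
    have := hLj j hj
    rw [A.nProd_eq_neg_sum _ c (m + n - j) (J := I) (fun i hi => hL _ _ (by omega)), smul_neg,
      Finset.smul_sum]
    congr 1
    refine Finset.sum_congr rfl fun i _ => ?_
    rw [map_nsmul, map_zsmul, show (m : ℤ) + n - j + i = m + n + i - j by ring,
      negOnePow_sub_natCast, mul_smul, smul_comm (m.choose j)]
  have e2 : ∀ j ∈ Finset.range (m + 1),
      m.choose j • A.productSum a b c 0 (m + n - j) (k + j) =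
      -∑ i ∈ Finset.range I, ((m + n + i).negOnePow : ℤ) • A.divT i (m.choose j • ((-1 : ℤ) ^ j •
        A.nProd (k + j) a (A.nProd (m + n + i - j) c b))) := by
    intro j hj
    have := Finset.mem_range.1 hj
    rw [productSum, zero_add, ← A.neg_sum_divT_nProd_nProd a b c (k + j) (m + n - j) (I := I)
      (fun i hi => hL _ _ (by omega)), smul_neg, Finset.smul_sum]
    congr 1
    refine Finset.sum_congr rfl fun i _ => ?_
    rw [map_nsmul, map_zsmul, show (m : ℤ) + n - j + i = m + n + i - j by ring,
      negOnePow_sub_natCast, mul_smul, smul_comm (m.choose j)]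
  rw [Finset.sum_congr rfl e1, Finset.sum_congr rfl e2, Finset.sum_neg_distrib,
    Finset.sum_neg_distrib, Finset.sum_comm, Finset.sum_comm (s := Finset.range (m + 1))]
  congr 1
  refine Finset.sum_congr rfl fun i _ => ?_
  rw [← Finset.smul_sum, ← map_sum, ← Finset.smul_sum, ← map_sum]
  have := hM₁ m (by omega) (n + i) k b
  rw [show n + (i : ℤ) + m = m + n + i by ring] at this
  rw [this]

/-- The Borcherds identity. -/
theorem borcherds (a b c : V) (m n k : ℤ) :
    A.iterateSum a b c m n k = A.productSum a b c m n k - A.oppositeSum a b c m n k := by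
  obtain ⟨N, hN⟩ := A.borcherds_of_locality a b c
  obtain ⟨M, hM⟩ := A.borcherds_of_associativity a b c
  induction hs : (M - m).toNat + (N - k).toNat generalizing m n k with
  | zero => exact hN m n k (by omega)
  | succ s ih =>
    by_cases hk : (N : ℤ) ≤ k
    · exact hN m n k hk
    by_cases hm : (M : ℤ) ≤ m
    · exact hM m n k hm
    -- The recurrence at `n - 1` expresses the case `(m, n, k)` through two cases nearer to `M ≤ m`
    -- or `N ≤ k`; shifting `n` is harmless since `M` and `N` do not depend on it.
    have h1 := ih (m + 1) (n - 1) k (by omega)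
    have h2 := ih m (n - 1) (k + 1) (by omega)
    rw [iterateSum_succ, productSum_succ, oppositeSum_succ, h2, sub_add_cancel] at h1
    rw [← sub_eq_zero] at h1 ⊢
    rw [← h1]
    abel

/-- The commutator formula `a_(m) b_(n) c - b_(n) a_(m) c = ∑ j, (m choose j) (a_(j) b)_(m+n-j) c`
for `m ≥ 0`. -/
theorem nProd_commutator (a b c : V) (m : ℕ) (n : ℤ) :
    A.nProd m a (A.nProd n b c) = A.nProd n b (A.nProd m a c) +
      ∑ j ∈ Finset.range (m + 1), m.choose j • A.nProd (m + n - j) (A.nProd j a b) c := by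
  have h := A.borcherds a b c m n 0
  rw [iterateSum, productSum, oppositeSum, binomialSum_natCast, binomialSum_zero,
    binomialSum_zero] at h
  simp only [zero_add, CharP.cast_eq_zero, add_zero, sub_zero, pow_zero, one_smul,
    Int.negOnePow_zero, Units.val_one] at h
  rw [h]
  abel

/-- The `(-1)`-st product of a normally ordered product. -/
theorem nProd_normal (a b c : V) {J : ℕ} (hb : ∀ j : ℕ, J ≤ j → A.nProd j b c = 0)
    (ha : ∀ j : ℕ, J ≤ j → A.nProd j a c = 0) :
    A.nProd (-1) (A.nProd (-1) a b) c = A.nProd (-1) a (A.nProd (-1) b c) +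
      ∑ j ∈ Finset.range J, A.nProd (-2 - j) a (A.nProd j b c) +
      ∑ j ∈ Finset.range J, A.nProd (-2 - j) b (A.nProd j a c) := by
  -- The left side reduces to its term `j = 0`. The index `-1 + j` on `b` forces the bound `J + 1`;
  -- the extra term `j = 0` is `a_(-1) b_(-1) c`.
  have h := A.borcherds a b c 0 (-1) (-1)
  rw [iterateSum, productSum, oppositeSum, binomialSum_zero,
    binomialSum_eq_sum_range (J := J + 1) _ fun j hj => by
      rw [show (-1 : ℤ) + j = (j - 1 : ℕ) by omega, hb _ (by omega)]; simp,
    binomialSum_eq_sum_range (J := J) _ fun j hj => by rw [zero_add, ha _ hj]; simp] at h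
  have s1 : ∀ j : ℕ, (-1 : ℤ) ^ j * (-1) ^ j = 1 := fun j => by
    rw [← mul_pow]; simp
  have s2 : ∀ j : ℕ, (-1 : ℤ) ^ j * ((-1 + (j : ℤ)).negOnePow : ℤ) = -1 := fun j => by
    rw [negOnePow_add_natCast, show ((-1 : ℤ).negOnePow : ℤ) = -1 by simp [Int.negOnePow_neg]]
    linear_combination (-1) * s1 j
  simp only [choose_neg_one, smul_smul, s1, s2, one_smul, Finset.sum_range_succ'] at h
  simp only [neg_smul, one_smul, Finset.sum_neg_distrib, sub_neg_eq_add] at h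
  have e1 : ∀ j : ℕ, (-1 : ℤ) - ((j + 1 : ℕ) : ℤ) = -2 - j := fun j => by push_cast; ring
  have e2 : ∀ j : ℕ, (-1 : ℤ) + ((j + 1 : ℕ) : ℤ) = j := fun j => by push_cast; ring
  have e3 : ∀ j : ℕ, (-1 : ℤ) + -1 - (j : ℤ) = -2 - j := fun j => by ring
  simp only [e1, e2, e3, zero_add, CharP.cast_eq_zero, sub_zero, add_zero] at h
  rw [h]
  abel

end Borcherds

end VertexAlgebra

/-! ### Coefficients of formal polynomials -/

section FormalPolynomials

variable {𝔽 V W U : Type*} [Field 𝔽] [AddCommGroup V] [Module 𝔽 V] [AddCommGroup W] [Module 𝔽 W]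
  [AddCommGroup U] [Module 𝔽 U]

/-- With `φ` a coefficient functional, terms of too high degree in the variable drop out even if
they are nonzero themselves. -/
theorem apply_polySubst_eq_sum_range (φ : W →ₗ[𝔽] U) (f : V →ₗ[𝔽] W) (s : Module.End 𝔽 W)
    (p : PolynomialModule 𝔽 V) {J : ℕ} (h : ∀ n, J ≤ n → φ ((s ^ n) (f (p.coeff n))) = 0) :
    φ (polySubst f s p) = ∑ n ∈ Finset.range J, φ ((s ^ n) (f (p.coeff n))) := by
  have e : φ (polySubst f s p) = ∑ n ∈ p.coeff.support, φ ((s ^ n) (f (p.coeff n))) :=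
    map_sum φ _ _
  rw [e, ← finsum_eq_sum_of_support_subset (fun n => φ ((s ^ n) (f (p.coeff n))))
      (s := p.coeff.support),
    ← finsum_eq_sum_of_support_subset (fun n => φ ((s ^ n) (f (p.coeff n))))
      (s := Finset.range J)]
  · intro n hn
    by_contra hn'
    exact hn (h n (by simpa using hn'))
  · intro n hn
    by_contra hn'
    refine hn ?_
    simp only [Finset.mem_coe, Finsupp.mem_support_iff, not_not] at hn'
    simp [hn']

theorem polySubst_eq_sum_range (f : V →ₗ[𝔽] W) (s : Module.End 𝔽 W)
    (p : PolynomialModule 𝔽 V) {J : ℕ} (h : ∀ n, J ≤ n → p.coeff n = 0) :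
    polySubst f s p = ∑ n ∈ Finset.range J, (s ^ n) (f (p.coeff n)) :=
  apply_polySubst_eq_sum_range LinearMap.id f s p fun n hn => by simp [h n hn]

theorem apply_polySubst_eq_single (φ : W →ₗ[𝔽] U) (f : V →ₗ[𝔽] W) (s : Module.End 𝔽 W)
    (p : PolynomialModule 𝔽 V) (k : ℕ)
    (h : ∀ n, n ≠ k → φ ((s ^ n) (f (p.coeff n))) = 0) :
    φ (polySubst f s p) = φ ((s ^ k) (f (p.coeff k))) := by
  rw [apply_polySubst_eq_sum_range φ f s p (J := k + 1) fun n hn => h n (by omega)]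
  exact Finset.sum_eq_single k (fun n _ hn => h n hn) (by simp)

theorem coeff_polySmul (r : 𝔽) (p : PolynomialModule 𝔽 V) (n : ℕ) :
    (r • p).coeff n = r • p.coeff n := rfl

theorem polyPrimitive_single (n : ℕ) (v : V) : polyPrimitive (PolynomialModule.single 𝔽 n v) =
    PolynomialModule.single 𝔽 (n + 1) (((n : 𝔽) + 1)⁻¹ • v) := by
  rw [PolynomialModule.single_smul]
  simp [polyPrimitive]
  rfl

theorem coeff_polyPrimitive_zero (p : PolynomialModule 𝔽 V) : (polyPrimitive p).coeff 0 = 0 := by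
  induction p using PolynomialModule.induction_linear with
  | zero => simp
  | add p q hp hq => simp [hp, hq]
  | single n v => simp [polyPrimitive_single]

theorem coeff_polyPrimitive_succ (p : PolynomialModule 𝔽 V) (n : ℕ) :
    (polyPrimitive p).coeff (n + 1) = ((n : 𝔽) + 1)⁻¹ • p.coeff n := by
  induction p using PolynomialModule.induction_linear with
  | zero => simp
  | add p q hp hq => simp [hp, hq]
  | single k v =>
    rw [polyPrimitive_single, PolynomialModule.coeff_single, PolynomialModule.coeff_single,
      Finsupp.single_apply, Finsupp.single_apply]
    by_cases h : k = n <;> simp [h]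

theorem coeff_polyMap (f : V →ₗ[𝔽] W) (p : PolynomialModule 𝔽 V) (n : ℕ) :
    (PolynomialModule.map 𝔽 f p).coeff n = f (p.coeff n) := rfl

theorem coeff_mulVar_zero (p : PolynomialModule 𝔽 V) : (mulVar 𝔽 V p).coeff 0 = 0 := by
  have h := PolynomialModule.monomial_smul_apply 1 (1 : 𝔽) p 0
  rw [monomial_one_one_eq_X] at h
  exact h

theorem coeff_mulVar_succ (p : PolynomialModule 𝔽 V) (n : ℕ) :
    (mulVar 𝔽 V p).coeff (n + 1) = p.coeff n := by
  have h := PolynomialModule.monomial_smul_apply 1 (1 : 𝔽) p (n + 1)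
  rw [monomial_one_one_eq_X] at h
  refine h.trans ?_
  simp

theorem coeff_mulVar_pow (p : PolynomialModule 𝔽 V) (i n : ℕ) :
    ((mulVar 𝔽 V ^ i) p).coeff n = if i ≤ n then p.coeff (n - i) else 0 := by
  induction i generalizing n with
  | zero => simp
  | succ i ih =>
    rw [pow_succ', Module.End.mul_apply]
    cases n with
    | zero => simp [coeff_mulVar_zero]
    | succ n => rw [coeff_mulVar_succ, ih]; simp

theorem coeff_polyMap_pow (f : Module.End 𝔽 V) (p : PolynomialModule 𝔽 V) (i n : ℕ) :
    (((PolynomialModule.map 𝔽 f : Module.End 𝔽 (PolynomialModule 𝔽 V)) ^ i) p).coeff n =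
      (f ^ i) (p.coeff n) := by
  induction i with
  | zero => simp
  | succ i ih => rw [pow_succ', Module.End.mul_apply, coeff_polyMap, ih, pow_succ', Module.End.mul_apply]

theorem commute_mulVar_map (f : Module.End 𝔽 V) :
    Commute (mulVar 𝔽 V) (PolynomialModule.map 𝔽 f : Module.End 𝔽 (PolynomialModule 𝔽 V)) := by
  refine LinearMap.ext fun p => PolynomialModule.coeff_injective (Finsupp.ext fun n => ?_)
  simp only [Module.End.mul_apply]
  cases n with
  | zero => simp [coeff_mulVar_zero, coeff_polyMap]
  | succ n => simp [coeff_mulVar_succ, coeff_polyMap]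

/-- The binomial theorem for commuting operators. It serves `λ + T` in skew-symmetry and `λ + μ` in
the Jacobi identity. -/
theorem coeff_mulVar_add_map_pow_lsingle (f : Module.End 𝔽 V) (v : V) (n k : ℕ) :
    (((mulVar 𝔽 V + PolynomialModule.map 𝔽 f) ^ n) (PolynomialModule.lsingle 𝔽 0 v)).coeff k =
      n.choose k • (f ^ (n - k)) v := by
  rw [(commute_mulVar_map f).add_pow]
  have hc : ∀ i, ((mulVar 𝔽 V ^ i * (PolynomialModule.map 𝔽 f : Module.End 𝔽
      (PolynomialModule 𝔽 V)) ^ (n - i) * (n.choose i : Module.End 𝔽 (PolynomialModule 𝔽 V)))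
      (PolynomialModule.lsingle 𝔽 0 v)).coeff k =
      if i = k then n.choose i • (f ^ (n - i)) v else 0 := by
    intro i
    rw [Module.End.mul_apply, Module.End.mul_apply, Module.End.natCast_apply, coeff_mulVar_pow,
      map_nsmul]
    split_ifs with h1 h2 h2
    · subst h2
      rw [← Nat.cast_smul_eq_nsmul 𝔽, coeff_polySmul, coeff_polyMap_pow, Nat.sub_self,
        PolynomialModule.lsingle_apply, if_pos rfl, Nat.cast_smul_eq_nsmul]
    · rw [← Nat.cast_smul_eq_nsmul 𝔽, coeff_polySmul, coeff_polyMap_pow,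
        PolynomialModule.lsingle_apply, if_neg (by omega), map_zero, smul_zero]
    · omega
    · rfl
  simp only [LinearMap.sum_apply, PolynomialModule.coeff_sum, Finsupp.finsetSum_apply, hc,
    Finset.sum_ite_eq', Finset.mem_range]
  split_ifs with h
  · rfl
  · rw [Nat.choose_eq_zero_of_lt (by omega), zero_smul]

variable (𝔽 V) in
/-- The coefficient of `λ ^ m μ ^ n`, as a linear functional on `V[λ][μ]`. -/
def coeffTwo (m n : ℕ) : PolynomialModule 𝔽 (PolynomialModule 𝔽 V) →ₗ[𝔽] V where
  toFun p := (p.coeff n).coeff m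
  map_add' _ _ := rfl
  map_smul' _ _ := rfl

theorem ext_coeffTwo {p q : PolynomialModule 𝔽 (PolynomialModule 𝔽 V)}
    (h : ∀ m n, coeffTwo 𝔽 V m n p = coeffTwo 𝔽 V m n q) : p = q :=
  PolynomialModule.coeff_injective <| Finsupp.ext fun n =>
    PolynomialModule.coeff_injective <| Finsupp.ext fun m => h m n

theorem coeffTwo_constTwo (m n : ℕ) (v : V) :
    coeffTwo 𝔽 V m n (constTwo 𝔽 V v) = if m = 0 ∧ n = 0 then v else 0 := by
  change (((PolynomialModule.lsingle 𝔽 0 (PolynomialModule.lsingle 𝔽 0 v) :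
    PolynomialModule 𝔽 (PolynomialModule 𝔽 V))).coeff n).coeff m = _
  rw [PolynomialModule.lsingle_apply]
  by_cases hn : n = 0
  · subst hn
    rw [if_pos rfl, PolynomialModule.lsingle_apply]
    simp [eq_comm]
  · rw [if_neg (Ne.symm hn), if_neg (fun h => hn h.2)]
    rfl

theorem coeffTwo_mulMu_pow (m n i : ℕ) (p : PolynomialModule 𝔽 (PolynomialModule 𝔽 V)) :
    coeffTwo 𝔽 V m n ((mulMu 𝔽 V ^ i) p) = if i ≤ n then coeffTwo 𝔽 V m (n - i) p else 0 := by
  change (((mulMu 𝔽 V ^ i) p).coeff n).coeff m = _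
  rw [mulMu, coeff_mulVar_pow]
  split_ifs <;> rfl

theorem coeffTwo_mulLambda_pow (m n i : ℕ) (p : PolynomialModule 𝔽 (PolynomialModule 𝔽 V)) :
    coeffTwo 𝔽 V m n ((mulLambda 𝔽 V ^ i) p) = if i ≤ m then coeffTwo 𝔽 V (m - i) n p else 0 := by
  change (((mulLambda 𝔽 V ^ i) p).coeff n).coeff m = _
  rw [mulLambda, coeff_polyMap_pow, coeff_mulVar_pow]
  rfl

theorem coeffTwo_polySubst_mulMu (m n : ℕ) (p : PolynomialModule 𝔽 V) :
    coeffTwo 𝔽 V m n (polySubst (constTwo 𝔽 V) (mulMu 𝔽 V) p) =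
      if m = 0 then p.coeff n else 0 := by
  rw [apply_polySubst_eq_single _ _ _ _ n]
  · simp [coeffTwo_mulMu_pow, coeffTwo_constTwo]
  · intro k hk
    rw [coeffTwo_mulMu_pow, coeffTwo_constTwo]
    split_ifs <;> first | rfl | omega

theorem coeffTwo_polySubst_mulLambda (m n : ℕ) (p : PolynomialModule 𝔽 V) :
    coeffTwo 𝔽 V m n (polySubst (constTwo 𝔽 V) (mulLambda 𝔽 V) p) =
      if n = 0 then p.coeff m else 0 := by
  rw [apply_polySubst_eq_single _ _ _ _ m]
  · simp [coeffTwo_mulLambda_pow, coeffTwo_constTwo]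
  · intro k hk
    rw [coeffTwo_mulLambda_pow, coeffTwo_constTwo]
    split_ifs <;> first | rfl | omega

theorem coeffTwo_mulLambda_add_mulMu_pow (m n k : ℕ) (v : V) :
    coeffTwo 𝔽 V m n (((mulLambda 𝔽 V + mulMu 𝔽 V) ^ k) (constTwo 𝔽 V v)) =
      if m + n = k then k.choose m • v else 0 := by
  rw [mulLambda, mulMu, add_comm]
  change ((((mulVar 𝔽 (PolynomialModule 𝔽 V) + PolynomialModule.map 𝔽 (mulVar 𝔽 V)) ^ k)
    (PolynomialModule.lsingle 𝔽 0 (PolynomialModule.lsingle 𝔽 0 v))).coeff n).coeff m = _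
  rw [coeff_mulVar_add_map_pow_lsingle, ← Nat.cast_smul_eq_nsmul 𝔽, coeff_polySmul,
    coeff_mulVar_pow]
  by_cases h : m + n = k
  · subst h
    rw [if_pos rfl, if_pos (by omega), show m - (m + n - n) = 0 by omega,
      PolynomialModule.lsingle_apply, if_pos rfl, Nat.cast_smul_eq_nsmul, Nat.choose_symm_add]
  · rw [if_neg h]
    split_ifs with h1
    · rcases lt_or_ge k n with h2 | h2
      · rw [Nat.choose_eq_zero_of_lt h2]
        simp
      · rw [PolynomialModule.lsingle_apply, if_neg (by omega), smul_zero]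
    · rw [smul_zero]

theorem coeffTwo_polySubst_mulLambda_add_mulMu (m n : ℕ) (p : PolynomialModule 𝔽 V) :
    coeffTwo 𝔽 V m n (polySubst (constTwo 𝔽 V) (mulLambda 𝔽 V + mulMu 𝔽 V) p) =
      (m + n).choose m • p.coeff (m + n) := by
  rw [apply_polySubst_eq_single _ _ _ _ (m + n)]
  · simp [coeffTwo_mulLambda_add_mulMu_pow]
  · intro k hk
    rw [coeffTwo_mulLambda_add_mulMu_pow, if_neg (Ne.symm hk)]

variable (br : V →ₗ[𝔽] V →ₗ[𝔽] PolynomialModule 𝔽 V) (a b c : V) (m n : ℕ)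

theorem coeffTwo_bracketRight_mulLambda_mulMu :
    coeffTwo 𝔽 V m n (bracketRight br (mulLambda 𝔽 V) (mulMu 𝔽 V) a b c) =
      (br a ((br b c).coeff n)).coeff m := by
  rw [bracketRight, apply_polySubst_eq_single _ _ _ _ n]
  · simp [coeffTwo_mulMu_pow, coeffTwo_polySubst_mulLambda]
  · intro k hk
    rw [coeffTwo_mulMu_pow, LinearMap.comp_apply, coeffTwo_polySubst_mulLambda]
    split_ifs <;> first | rfl | omega

theorem coeffTwo_bracketRight_mulMu_mulLambda :
    coeffTwo 𝔽 V m n (bracketRight br (mulMu 𝔽 V) (mulLambda 𝔽 V) a b c) =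
      (br a ((br b c).coeff m)).coeff n := by
  rw [bracketRight, apply_polySubst_eq_single _ _ _ _ m]
  · simp [coeffTwo_mulLambda_pow, coeffTwo_polySubst_mulMu]
  · intro k hk
    rw [coeffTwo_mulLambda_pow, LinearMap.comp_apply, coeffTwo_polySubst_mulMu]
    split_ifs <;> first | rfl | omega

theorem coeffTwo_bracketLeft_mulLambda_mulMu :
    coeffTwo 𝔽 V m n (bracketLeft br (mulLambda 𝔽 V) (mulMu 𝔽 V) a b c) =
      (br ((br a b).coeff m) c).coeff n := by
  rw [bracketLeft, apply_polySubst_eq_single _ _ _ _ m]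
  · simp [coeffTwo_mulLambda_pow, coeffTwo_polySubst_mulMu]
  · intro k hk
    rw [coeffTwo_mulLambda_pow, LinearMap.comp_apply, coeffTwo_polySubst_mulMu]
    split_ifs <;> first | rfl | omega

theorem coeffTwo_bracketLeft_mulLambda_add :
    coeffTwo 𝔽 V m n (bracketLeft br (mulLambda 𝔽 V) (mulLambda 𝔽 V + mulMu 𝔽 V) a b c) =
      ∑ j ∈ Finset.range (m + 1),
        (m - j + n).choose (m - j) • (br ((br a b).coeff j) c).coeff (m - j + n) := by
  rw [bracketLeft, apply_polySubst_eq_sum_range (J := m + 1)]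
  · refine Finset.sum_congr rfl fun j hj => ?_
    rw [coeffTwo_mulLambda_pow, if_pos (Nat.lt_succ_iff.1 (Finset.mem_range.1 hj)),
      LinearMap.comp_apply, coeffTwo_polySubst_mulLambda_add_mulMu]
    rfl
  · intro k hk
    rw [coeffTwo_mulLambda_pow, if_neg (by omega)]

/-- `μ^n` integrates to `λ^(n + 1) / (n + 1)`, so `λ^i μ^n` contributes to `λ^m` exactly when `i = m
- (n + 1)`. -/
theorem coeff_polyIntegral_zero_mulVar (p : PolynomialModule 𝔽 (PolynomialModule 𝔽 V)) :
    (polyIntegral 0 (mulVar 𝔽 V) p).coeff m =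
      ∑ n ∈ Finset.range m, ((n : 𝔽) + 1)⁻¹ • coeffTwo 𝔽 V (m - (n + 1)) n p := by
  let φ : PolynomialModule 𝔽 V →ₗ[𝔽] V :=
    { toFun := fun q => q.coeff m, map_add' := fun _ _ => rfl, map_smul' := fun _ _ => rfl }
  change φ (polyIntegral 0 (mulVar 𝔽 V) p) = _
  rw [polyIntegral, map_sub, apply_polySubst_eq_sum_range φ _ (mulVar 𝔽 V) _ (J := m + 1),
    apply_polySubst_eq_single φ _ 0 _ 0, Finset.sum_range_succ']
  · simp only [coeff_polyPrimitive_zero, map_zero, add_zero, sub_zero]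
    refine Finset.sum_congr rfl fun n hn => ?_
    have hn := Finset.mem_range.1 hn
    rw [coeff_polyPrimitive_succ, map_smul, map_smul, map_smul]
    congr 1
    change ((mulVar 𝔽 V ^ (n + 1)) (p.coeff n)).coeff m = _
    rw [coeff_mulVar_pow, if_pos (by omega)]
    rfl
  · intro n hn
    rw [zero_pow hn]; simp
  · intro n hn
    change ((mulVar 𝔽 V ^ n) _).coeff m = _
    rw [coeff_mulVar_pow, if_neg (by omega)]

end FormalPolynomials

/-! ### Properties of the `λ`-bracket and of the normally ordered product. -/

namespace VertexAlgebra

variable {𝔽 V : Type*} [Field 𝔽] [AddCommGroup V] [Module 𝔽 V] (A : VertexAlgebra 𝔽 V)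

theorem T_nProd_eq (n : ℤ) (a b : V) :
    A.nProd n a (A.T b) = n • A.nProd (n - 1) a b + A.T (A.nProd n a b) := by
  rw [T_nProd, nProd_T]; simp

variable [CharZero 𝔽]

theorem succ_smul_inv_factorial_succ (n : ℕ) :
    ((n : 𝔽) + 1) * (((n + 1).factorial : 𝔽))⁻¹ = ((n.factorial : 𝔽))⁻¹ := by
  have h : (n.factorial : 𝔽) ≠ 0 := Nat.cast_ne_zero.2 n.factorial_ne_zero
  have h' : ((n : 𝔽) + 1) ≠ 0 := by exact_mod_cast Nat.succ_ne_zero n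
  rw [Nat.factorial_succ]
  push_cast
  field_simp

theorem lambdaBracket_T_left (a b : V) :
    A.lambdaBracket (A.T a) b = -(mulVar 𝔽 V (A.lambdaBracket a b)) := by
  refine PolynomialModule.coeff_injective (Finsupp.ext fun n => ?_)
  change _ = -((mulVar 𝔽 V (A.lambdaBracket a b)).coeff n)
  rw [coeff_lambdaBracket, nProd_T]
  cases n with
  | zero => simp [coeff_mulVar_zero]
  | succ n =>
    rw [coeff_mulVar_succ, coeff_lambdaBracket, ← succ_smul_inv_factorial_succ n,
      ← Int.cast_smul_eq_zsmul 𝔽, smul_smul, ← neg_smul,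
      show ((n + 1 : ℕ) : ℤ) - 1 = n by push_cast; ring]
    congr 1
    push_cast
    ring

theorem lambdaBracket_T_right (a b : V) : A.lambdaBracket a (A.T b) =
    (mulVar 𝔽 V + PolynomialModule.map 𝔽 A.T) (A.lambdaBracket a b) := by
  refine PolynomialModule.coeff_injective (Finsupp.ext fun n => ?_)
  rw [LinearMap.add_apply, PolynomialModule.coeff_add, Finsupp.add_apply, coeff_polyMap,
    coeff_lambdaBracket, coeff_lambdaBracket, T_nProd_eq, smul_add, map_smul]
  congr 1
  cases n with
  | zero => simp [coeff_mulVar_zero]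
  | succ n =>
    rw [coeff_mulVar_succ, coeff_lambdaBracket, ← succ_smul_inv_factorial_succ n,
      ← Int.cast_smul_eq_zsmul 𝔽, smul_smul,
      show ((n + 1 : ℕ) : ℤ) - 1 = n by push_cast; ring]
    congr 1
    push_cast
    ring

theorem lambdaBracket_skew (a b : V) : A.lambdaBracket b a =
    -(polySubst (PolynomialModule.lsingle 𝔽 0) (-mulVar 𝔽 V - PolynomialModule.map 𝔽 A.T)
      (A.lambdaBracket a b)) := by
  refine PolynomialModule.coeff_injective (Finsupp.ext fun k => ?_)
  obtain ⟨N, hN⟩ := A.exists_nProd_eq_zero a b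
  -- The range is split at `k`: terms `n < k` carry `n.choose k = 0`, and `n = k + j` gives the
  -- `j`-th term of skew-symmetry.
  rw [polySubst_eq_sum_range (J := k + N) _ _ _ fun n hn => by
    rw [coeff_lambdaBracket, hN _ (by omega), smul_zero]]
  change _ = -((∑ n ∈ Finset.range (k + N), _ : PolynomialModule 𝔽 V).coeff k)
  rw [PolynomialModule.coeff_sum, Finsupp.finsetSum_apply, coeff_lambdaBracket,
    A.nProd_eq_neg_sum b a k (J := N) (fun j hj => hN _ (by omega)), smul_neg,
    Finset.sum_range_add, Finset.smul_sum]
  have hs : -mulVar 𝔽 V - PolynomialModule.map 𝔽 A.T =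
    -(mulVar 𝔽 V + PolynomialModule.map 𝔽 A.T) := by abel
  have hc : ∀ n, (((-mulVar 𝔽 V - PolynomialModule.map 𝔽 A.T) ^ n) (PolynomialModule.lsingle 𝔽 0
      ((A.lambdaBracket a b).coeff n))).coeff k =
      ((-1 : ℤ) ^ n * n.choose k) • (A.T ^ (n - k)) ((A.lambdaBracket a b).coeff n) := by
    intro n
    rw [hs, neg_pow, mul_smul, natCast_zsmul, ← coeff_mulVar_add_map_pow_lsingle]
    rcases Nat.even_or_odd n with h | h
    · simp [h.neg_one_pow]
    · simp only [h.neg_one_pow, neg_one_mul, neg_smul, one_smul]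
      rfl
  congr 1
  simp only [hc]
  rw [Finset.sum_eq_zero (s := Finset.range k), zero_add]
  · refine Finset.sum_congr rfl fun j _ => ?_
    rw [coeff_lambdaBracket, ← Nat.cast_add, negOnePow_natCast, Nat.add_sub_cancel_left, mul_smul,
      smul_comm _ ((-1 : ℤ) ^ _), map_smul, natCast_zsmul, ← Nat.cast_smul_eq_nsmul 𝔽, smul_smul,
      divT, LinearMap.smul_apply, smul_smul]
    congr 2
    have h : ∀ i : ℕ, (i.factorial : 𝔽) ≠ 0 := fun i => Nat.cast_ne_zero.2 i.factorial_ne_zero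
    rw [Nat.cast_choose 𝔽 (Nat.le_add_right k j), Nat.add_sub_cancel_left]
    field_simp [h]
  · intro n hn
    rw [Nat.choose_eq_zero_of_lt (Finset.mem_range.1 hn)]
    simp

/-- The coefficient of `λ^m μ^n` is the commutator formula divided by `m! n!`. -/
theorem lambdaBracket_jacobi (a b c : V) :
    bracketRight A.lambdaBracket (mulLambda 𝔽 V) (mulMu 𝔽 V) a b c =
      bracketLeft A.lambdaBracket (mulLambda 𝔽 V) (mulLambda 𝔽 V + mulMu 𝔽 V) a b c +
      bracketRight A.lambdaBracket (mulMu 𝔽 V) (mulLambda 𝔽 V) b a c := by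
  refine ext_coeffTwo fun m n => ?_
  rw [map_add, coeffTwo_bracketRight_mulLambda_mulMu, coeffTwo_bracketRight_mulMu_mulLambda,
    coeffTwo_bracketLeft_mulLambda_add]
  simp only [coeff_lambdaBracket, map_smul, LinearMap.smul_apply, coeff_polySmul]
  rw [nProd_commutator, smul_add, smul_add, add_comm]
  congr 1
  · rw [Finset.smul_sum, Finset.smul_sum]
    refine Finset.sum_congr rfl fun j hj => ?_
    have hj := Nat.lt_succ_iff.1 (Finset.mem_range.1 hj)
    rw [show (m : ℤ) + n - j = (m - j + n : ℕ) by omega]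
    simp only [← Nat.cast_smul_eq_nsmul 𝔽, smul_smul]
    congr 1
    rw [Nat.cast_choose 𝔽 hj, Nat.cast_choose 𝔽 (Nat.le_add_right _ _), Nat.add_sub_cancel_left]
    have h : ∀ i : ℕ, (i.factorial : 𝔽) ≠ 0 := fun i => Nat.cast_ne_zero.2 i.factorial_ne_zero
    field_simp [h]
  · exact smul_comm _ _ _

/-- The commutator formula at `n = -1`, divided by `m!`: the term `j = m` is `:(a_(m) b)c:`, and the
terms `j < m` form the integral. -/
theorem normalProd_wick : NoncommutativeWick A.normalProd A.lambdaBracket := by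
  intro a b c
  refine PolynomialModule.coeff_injective (Finsupp.ext fun m => ?_)
  rw [PolynomialModule.coeff_add, PolynomialModule.coeff_add, Finsupp.add_apply, Finsupp.add_apply,
    coeff_polyMap, coeff_polyMap, coeff_polyIntegral_zero_mulVar]
  simp only [coeffTwo_bracketLeft_mulLambda_mulMu, coeff_lambdaBracket, map_smul,
    LinearMap.smul_apply, coeff_polySmul, LinearMap.flip_apply, normalProd]
  rw [nProd_commutator, Finset.sum_range_succ, smul_add, smul_add, ← Finset.sum_range_reflect]
  have e : ∑ n ∈ Finset.range m, ((n : 𝔽) + 1)⁻¹ • (((m - (n + 1)).factorial : 𝔽))⁻¹ •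
      ((n.factorial : 𝔽))⁻¹ • A.nProd n (A.nProd (m - (n + 1) : ℕ) a b) c =
      ((m.factorial : 𝔽))⁻¹ • ∑ n ∈ Finset.range m, m.choose (m - 1 - n) •
        A.nProd (m + -1 - (m - 1 - n : ℕ)) (A.nProd (m - 1 - n : ℕ) a b) c := by
    rw [Finset.smul_sum]
    refine Finset.sum_congr rfl fun n hn => ?_
    have hn := Finset.mem_range.1 hn
    rw [show (m : ℤ) + -1 - (m - 1 - n : ℕ) = n by omega, show m - 1 - n = m - (n + 1) by omega,
      Nat.choose_symm (by omega : n + 1 ≤ m)]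
    simp only [← Nat.cast_smul_eq_nsmul 𝔽, smul_smul]
    congr 1
    rw [Nat.cast_choose 𝔽 (by omega : n + 1 ≤ m), ← mul_assoc, ← mul_inv, ← mul_inv,
      Nat.factorial_succ]
    have h : ∀ i : ℕ, (i.factorial : 𝔽) ≠ 0 := fun i => Nat.cast_ne_zero.2 i.factorial_ne_zero
    have h' : ((n : 𝔽) + 1) ≠ 0 := by exact_mod_cast Nat.succ_ne_zero n
    push_cast
    field_simp [h]
  rw [e, show (m : ℤ) + -1 - m = -1 by ring, Nat.choose_self, one_smul]
  abel

/-- Skew-symmetry at `n = -1`: the term `j = 0` is `:ab:`, the others form the integral. -/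
theorem normalProd_quasicommutative : IsQuasicommutative A.T A.normalProd A.lambdaBracket := by
  intro a b
  obtain ⟨N, hN⟩ := A.exists_nProd_eq_zero a b
  have h := A.nProd_eq_neg_sum b a (-1) (J := N + 1) (fun j hj => hN _ (by omega))
  rw [Finset.sum_range_succ'] at h
  have e0 : polySubst LinearMap.id 0 (polyPrimitive (A.lambdaBracket a b)) = 0 := by
    have := apply_polySubst_eq_single LinearMap.id LinearMap.id 0
      (polyPrimitive (A.lambdaBracket a b)) 0 (fun n hn => by rw [zero_pow hn]; simp)
    simpa [coeff_polyPrimitive_zero] using this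
  rw [polyIntegral, e0, polySubst_eq_sum_range (J := N + 1), Finset.sum_range_succ', normalProd, h]
  · have e : ∀ j : ℕ, (((-1 : ℤ) + (j + 1 : ℕ)).negOnePow : ℤ) •
        A.divT (j + 1) (A.nProd (-1 + (j + 1 : ℕ)) a b) =
        -((-A.T) ^ (j + 1)) ((LinearMap.id : V →ₗ[𝔽] V) ((polyPrimitive (A.lambdaBracket a b)).coeff (j + 1))) := by
      intro j
      rw [show (-1 : ℤ) + (j + 1 : ℕ) = j by push_cast; ring, negOnePow_natCast,
        LinearMap.id_apply, coeff_polyPrimitive_succ, coeff_lambdaBracket, smul_smul, map_smul,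
        ← mul_inv, divT, Nat.factorial_succ, Nat.cast_mul, Nat.cast_succ, LinearMap.smul_apply,
        smul_comm, ← smul_neg]
      congr 1
      rcases Nat.even_or_odd j with h | h
      · rw [h.neg_one_pow, h.add_one.neg_pow, one_smul, LinearMap.neg_apply, neg_neg]
      · rw [h.neg_one_pow, h.add_one.neg_pow, neg_one_smul]
    simp only [e, coeff_polyPrimitive_zero, divT_zero]
    simp
  · intro n hn
    obtain ⟨n, rfl⟩ := Nat.exists_eq_succ_of_ne_zero (show n ≠ 0 by omega)
    rw [coeff_polyPrimitive_succ, coeff_lambdaBracket, hN _ (by omega)]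
    simp

/-- `(T^(j + 1) a / (j + 1)!)_(-1) = a_(-2 - j)`; the leftover `j!` cancels the one in the
`λ`-bracket. -/
theorem integralAct_eq_sum_range (a b c : V) {J : ℕ} (h : ∀ j : ℕ, J ≤ j → A.nProd j b c = 0) :
    integralAct A.T A.normalProd a (A.lambdaBracket b c) =
      ∑ j ∈ Finset.range J, A.nProd (-2 - j) a (A.nProd j b c) := by
  rw [integralAct, Finsupp.sum_of_support_subset (s := Finset.range J)]
  · refine Finset.sum_congr rfl fun j _ => ?_
    have hd : ((j : 𝔽) + 1)⁻¹ • (A.T ^ (j + 1)) a = (j.factorial : 𝔽) • A.divT (j + 1) a := by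
      have h : (j.factorial : 𝔽) ≠ 0 := Nat.cast_ne_zero.2 j.factorial_ne_zero
      rw [divT, LinearMap.smul_apply, smul_smul, Nat.factorial_succ]
      congr 1
      push_cast
      field_simp
    have hj : (j.factorial : 𝔽) ≠ 0 := Nat.cast_ne_zero.2 j.factorial_ne_zero
    rw [hd, coeff_lambdaBracket, normalProd, map_smul, map_smul, LinearMap.smul_apply, smul_smul,
      inv_mul_cancel₀ hj, one_smul, nProd_divT, choose_neg_one, ← mul_pow,
      show (-1 : ℤ) - (j + 1 : ℕ) = -2 - j by push_cast; ring]
    simp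
  · intro j hj
    by_contra hj'
    rw [Finsupp.mem_support_iff, coeff_lambdaBracket, h j (by simpa using hj'), smul_zero] at hj
    exact hj rfl
  · simp

theorem normalProd_quasiassociative : IsQuasiassociative A.T A.normalProd A.lambdaBracket := by
  intro a b c
  obtain ⟨N₁, h₁⟩ := A.exists_nProd_eq_zero b c
  obtain ⟨N₂, h₂⟩ := A.exists_nProd_eq_zero a c
  have hb : ∀ j : ℕ, N₁ + N₂ ≤ j → A.nProd j b c = 0 := fun j hj => h₁ _ (by omega)
  have ha : ∀ j : ℕ, N₁ + N₂ ≤ j → A.nProd j a c = 0 := fun j hj => h₂ _ (by omega)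
  rw [A.integralAct_eq_sum_range a b c hb, A.integralAct_eq_sum_range b a c ha, normalProd,
    A.nProd_normal a b c hb ha]
  abel

end VertexAlgebra

end

theorem theorem4p1 {𝔽 V : Type*} [Field 𝔽] [CharZero 𝔽] [AddCommGroup V] [Module 𝔽 V]
    (A : VertexAlgebra 𝔽 V) :
    IsLieConformalAlgebra A.T A.lambdaBracket ∧
    (IsUnitalDifferentialAlgebra A.vac A.T A.normalProd ∧
      IsQuasicommutative A.T A.normalProd A.lambdaBracket ∧
      IsQuasiassociative A.T A.normalProd A.lambdaBracket) ∧
    NoncommutativeWick A.normalProd A.lambdaBracket :=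
  ⟨⟨A.lambdaBracket_T_left, A.lambdaBracket_T_right, A.lambdaBracket_skew,
      A.lambdaBracket_jacobi⟩,
    ⟨⟨fun a => by simp [VertexAlgebra.normalProd, VertexAlgebra.nProd_vac_left],
      A.nProd_neg_one_vac, A.T_nProd (-1)⟩,
      A.normalProd_quasicommutative, A.normalProd_quasiassociative⟩,
    A.normalProd_wick⟩
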